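/- Let $K$ be an algebraically closed field (of arbitrary characteristic), let $X=(x_{ij})$ be the generic $4\times 4$ matrix, and let $S=K[X]$ be the polynomial ring over $K$ in its $16$ entries. Let $P_3\subseteq S$ be the ideal generated by the principal $3$-minors of $X$ (the $3\times 3$ minors whose row and column index sets coincide), let $I_3\subseteq S$ be the ideal generated by all $3\times 3$ minors of $X$, and let $Q_3$ be the contraction to $S$ of the extended ideal $P_3\,S[\tfrac{1}{\Delta}]$, where $\Delta=\det X$. Then $P_3$ is reduced (that is, the ring $S/P_3$ is reduced, equivalently $P_3$ is a radical ideal), and hence $P_3=I_3\cap Q_3$. -/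

import Mathlib

/-- The ideal `P_t` of `K[X]`, `X = (x_ij)` the generic `n × n` matrix, generated by the principal
minors of size `t`: those with the same row and column indices `r 0 < ⋯ < r (t - 1)`. -/
noncomputable def principalMinorIdeal (K : Type*) [CommRing K] (n t : ℕ) :
    Ideal (MvPolynomial (Fin n × Fin n) K) :=
  Ideal.span (Set.range fun r : Fin t ↪o Fin n =>
    ((Matrix.mvPolynomialX (Fin n) (Fin n) K).submatrix r r).det)

/-- The determinantal ideal `I_t` of `K[X]`, generated by all minors of size `t` of the generic
`n × n` matrix `X`. -/
noncomputable def determinantalIdeal (K : Type*) [CommRing K] (n t : ℕ) :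
    Ideal (MvPolynomial (Fin n × Fin n) K) :=
  Ideal.span (Set.range fun p : (Fin t ↪o Fin n) × (Fin t ↪o Fin n) =>
    ((Matrix.mvPolynomialX (Fin n) (Fin n) K).submatrix p.1 p.2).det)

/-- The determinant `Δ = det X` of the generic `n × n` matrix. -/
noncomputable def genericDet (K : Type*) [CommRing K] (n : ℕ) :
    MvPolynomial (Fin n × Fin n) K :=
  (Matrix.mvPolynomialX (Fin n) (Fin n) K).det

/-- The ideal `Q_t`: the contraction to `S = K[X]` of the extension of `P_t` to
`S_Δ = K[X][1 / det X]`. -/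
noncomputable def contractedPrincipalMinorIdeal (K : Type*) [CommRing K] (n t : ℕ) :
    Ideal (MvPolynomial (Fin n × Fin n) K) :=
  ((principalMinorIdeal K n t).map
    (algebraMap (MvPolynomial (Fin n × Fin n) K) (Localization.Away (genericDet K n)))).comap
    (algebraMap (MvPolynomial (Fin n × Fin n) K) (Localization.Away (genericDet K n)))

/-! Let g_i be the principal 3-minor omitting the index i, and J = (g_1, g_2, g_3). In a suitable
lex order the leading terms of g_1, g_2, g_3 are pairwise coprime and free of diagonal entries, so
powers of x_00 and x_11 form a regular sequence modulo J. Once x_00 is inverted, a change of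
variables turns the g_i into three principal 2-minors of the Schur complement Y and det(Y + c r). In
a second lex order these have coprime squarefree leading terms, so they generate a radical ideal,
and g_0 is regular modulo J. Thus an element of the radical of P_3 enters P_3 after multiplication
by a power of x_00 and, by symmetry, by a power of x_11; regularity cancels both
(`mem_of_mul_pow_mem`).

Given radicality, the Nullstellensatz reduces the intersection formula to points: f in I_3 ∩ Q_3
must vanish at each matrix A with zero principal 3-minors. If A is nonsingular, membership in Q_3
suffices; if all 3-minors of A vanish, membership in I_3 does. In rank 3, `exists_deformation` makes
A the value at T = 0 of a matrix over K[T] with zero principal 3-minors and nonzero determinant; f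
vanishes on this family, hence at A. -/

namespace MonomialOrder

open MvPolynomial
open scoped MonomialOrder

/-! ### Gröbner sets and coprime leading exponents. -/

section Groebner

variable {σ K : Type*} [Field K]

/-- A set of polynomials whose leading exponents generate the leading exponents of the ideal
it spans. -/
structure IsGroebner (m : MonomialOrder σ) (B : Set (MvPolynomial σ K)) : Prop where
  ne_zero : ∀ b ∈ B, b ≠ 0
  exists_le : ∀ f ∈ Ideal.span B, f ≠ 0 → ∃ b ∈ B, m.degree b ≤ m.degree f

variable {m : MonomialOrder σ} {B : Set (MvPolynomial σ K)}

theorem isGroebner_empty : m.IsGroebner (∅ : Set (MvPolynomial σ K)) where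
  ne_zero := by simp
  exists_le := by simp

theorem IsGroebner.exists_remainder (hB : m.IsGroebner B) (f : MvPolynomial σ K) :
    ∃ r, f - r ∈ Ideal.span B ∧ (r ≠ 0 → ∀ b ∈ B, ¬ m.degree b ≤ m.degree r) := by
  obtain ⟨g, r, hf, -, hr⟩ := m.div_set (B := B)
    (fun b hb => (m.leadingCoeff_ne_zero_iff.2 (hB.ne_zero b hb)).isUnit) f
  refine ⟨r, ?_, fun h0 => hr _ (m.degree_mem_support h0)⟩
  rw [hf, add_sub_cancel_right, Finsupp.linearCombination_apply]
  exact Submodule.sum_mem _ fun b _ => Submodule.smul_mem _ _ (Ideal.subset_span b.2)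

theorem not_degree_le_degree_mul {b r g : MvPolynomial σ K} (hr : r ≠ 0) (hg : g ≠ 0)
    (hd : Disjoint (m.degree b).support (m.degree g).support)
    (h : ¬ m.degree b ≤ m.degree r) : ¬ m.degree b ≤ m.degree (r * g) := by
  rw [m.degree_mul hr hg]
  refine fun hle => h fun v => ?_
  by_cases hv : v ∈ (m.degree b).support
  · have : m.degree g v = 0 := Finsupp.notMem_support_iff.1 (Finset.disjoint_left.1 hd hv)
    simpa [this] using hle v
  · simp [Finsupp.notMem_support_iff.1 hv]

/-- A polynomial whose leading exponent is disjoint from those of a Gröbner set is regular modulo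
that set. -/
theorem IsGroebner.mem_of_mul_mem (hB : m.IsGroebner B) {a g : MvPolynomial σ K} (hg : g ≠ 0)
    (hd : ∀ b ∈ B, Disjoint (m.degree b).support (m.degree g).support)
    (h : a * g ∈ Ideal.span B) : a ∈ Ideal.span B := by
  obtain ⟨r, har, hr⟩ := hB.exists_remainder a
  have hrg : r * g ∈ Ideal.span B := by
    have := Ideal.sub_mem _ h (Ideal.mul_mem_right g _ har)
    rwa [sub_mul, sub_sub_cancel] at this
  by_cases h0 : r = 0
  · simpa [h0] using har
  · obtain ⟨b, hb, hle⟩ := hB.exists_le _ hrg (mul_ne_zero h0 hg)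
    exact absurd hle (not_degree_le_degree_mul h0 hg (hd b hb) (hr h0 b hb))

/-- After reducing the coefficient of `g` modulo `B` to a remainder `r`, no leading exponent from
`B` divides that of `r * g`, by coprimality, so it cannot cancel against an element of the span of
`B`. No S-polynomials are needed. -/
theorem IsGroebner.insert (hB : m.IsGroebner B) {g : MvPolynomial σ K} (hg : g ≠ 0)
    (hd : ∀ b ∈ B, Disjoint (m.degree b).support (m.degree g).support) :
    m.IsGroebner (insert g B) where
  ne_zero := by
    rintro b (rfl | hb)
    exacts [hg, hB.ne_zero b hb]
  exists_le := by
    intro f hf hf0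
    obtain ⟨a, z, hz, rfl⟩ := Ideal.mem_span_insert.1 hf
    obtain ⟨r, har, hr⟩ := hB.exists_remainder a
    obtain ⟨j, hj, hfj⟩ : ∃ j ∈ Ideal.span B, a * g + z = r * g + j :=
      ⟨(a - r) * g + z, Ideal.add_mem _ (Ideal.mul_mem_right g _ har) hz, by ring⟩
    rw [hfj] at hf0 ⊢
    by_cases h0 : r = 0
    · subst h0
      rw [zero_mul, zero_add] at hf0 ⊢
      obtain ⟨b, hb, hle⟩ := hB.exists_le j hj hf0
      exact ⟨b, Set.mem_insert_of_mem _ hb, hle⟩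
    have hgle : m.degree g ≤ m.degree (r * g) := by
      rw [m.degree_mul h0 hg]
      exact le_add_self
    by_cases hj0 : j = 0
    · subst hj0
      rw [add_zero]
      exact ⟨g, Set.mem_insert _ _, hgle⟩
    obtain ⟨b, hb, hle⟩ := hB.exists_le j hj hj0
    rcases lt_trichotomy (m.toSyn (m.degree j)) (m.toSyn (m.degree (r * g))) with hlt | heq | hlt
    · rw [m.degree_add_of_lt hlt]
      exact ⟨g, Set.mem_insert _ _, hgle⟩
    · rw [m.toSyn.injective heq] at hle
      exact absurd hle (not_degree_le_degree_mul h0 hg (hd b hb) (hr h0 b hb))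
    · rw [m.degree_add_eq_right_of_lt hlt]
      exact ⟨b, Set.mem_insert_of_mem _ hb, hle⟩

/-- An ideal with squarefree leading exponents is radical. -/
theorem IsGroebner.isRadical (hB : m.IsGroebner B) (hsq : ∀ b ∈ B, ∀ v, m.degree b v ≤ 1) :
    (Ideal.span B).IsRadical := by
  rintro f ⟨n, hn⟩
  obtain ⟨r, hfr, hr⟩ := hB.exists_remainder f
  have hrn : r ^ n ∈ Ideal.span B := by
    have := Ideal.sub_mem _ hn (Ideal.mem_of_dvd _ (sub_dvd_pow_sub_pow f r n) hfr)
    rwa [sub_sub_cancel] at this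
  by_cases h0 : r = 0
  · simpa [h0] using hfr
  obtain ⟨b, hb, hle⟩ := hB.exists_le _ hrn (pow_ne_zero n h0)
  -- A squarefree exponent dividing a multiple of `m.degree r` divides `m.degree r` itself.
  refine absurd (fun v => ?_) (hr h0 b hb)
  have h1 := hle v
  have h2 := hsq b hb v
  rw [m.degree_pow, Finsupp.smul_apply, smul_eq_mul] at h1
  rcases Nat.eq_zero_or_pos (m.degree r v) with h | h
  · rw [h, mul_zero] at h1
    exact h1.trans (Nat.zero_le _)
  · exact h2.trans h

end Groebner

/-! ### Polynomials given by explicit lists of terms. -/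

section Lists

variable {σ : Type*} [DecidableEq σ]

/-- The exponent of the product of the variables in a list. -/
noncomputable def listExponent (l : List σ) : σ →₀ ℕ := Multiset.toFinsupp (l : Multiset σ)

@[simp]
theorem listExponent_apply (l : List σ) (v : σ) : listExponent l v = l.count v := by
  simp [listExponent]

theorem listExponent_le_one {l : List σ} (h : l.Nodup) (v : σ) : listExponent l v ≤ 1 := by
  rw [listExponent_apply]
  exact List.nodup_iff_count_le_one.1 h v

theorem disjoint_support_listExponent {l l' : List σ} (h : ∀ v ∈ l, v ∉ l') :
    Disjoint (listExponent l).support (listExponent l').support := by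
  rw [Finset.disjoint_left]
  intro v hv hv'
  rw [Finsupp.mem_support_iff, listExponent_apply, ← Nat.pos_iff_ne_zero, List.count_pos_iff]
    at hv hv'
  exact h v hv hv'

variable (K : Type*) [Field K]

/-- The polynomial with the given list of terms. -/
noncomputable def ofTerms (L : List (ℤ × List σ)) : MvPolynomial σ K :=
  (L.map fun t => C (t.1 : K) * (t.2.map X).prod).sum

variable {K}

theorem prod_map_X (l : List σ) :
    (l.map X).prod = monomial (listExponent l) (1 : K) := by
  induction l with
  | nil => simp [listExponent]
  | cons a l ih =>
    rw [List.map_cons, List.prod_cons, ih, X, monomial_mul, one_mul]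
    have h : Finsupp.single a 1 + listExponent l = listExponent (a :: l) := by
      ext v
      simp [Finsupp.single_apply, List.count_cons, add_comm]
    rw [h]

theorem degree_X_pow (m : MonomialOrder σ) (v : σ) (N : ℕ) :
    m.degree (X v ^ N : MvPolynomial σ K) = listExponent (List.replicate N v) := by
  rw [m.degree_pow, degree_X]
  ext w
  simp [Finsupp.single_apply, List.count_replicate]

theorem lt_of_mem_support_ofTerms {m : MonomialOrder σ} {d : σ →₀ ℕ} {L : List (ℤ × List σ)}
    (h : ∀ t ∈ L, listExponent t.2 ≺[m] d) {e : σ →₀ ℕ} (he : e ∈ (ofTerms K L).support) :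
    e ≺[m] d := by
  induction L with
  | nil => simp [ofTerms] at he
  | cons t L ih =>
    rw [ofTerms, List.map_cons, List.sum_cons, prod_map_X, C_mul_monomial] at he
    rcases Finset.mem_union.1 (support_add he) with h1 | h1
    · rw [Finset.mem_singleton.1 (support_monomial_subset h1)]
      exact h t (by simp)
    · exact ih (fun t ht => h t (by simp [ht])) h1

theorem degree_ofTerms_cons {m : MonomialOrder σ} {c : ℤ} (hc : (c : K) ≠ 0) {l : List σ}
    {L : List (ℤ × List σ)} (h : ∀ t ∈ L, listExponent t.2 ≺[m] listExponent l) :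
    m.degree (ofTerms K ((c, l) :: L)) = listExponent l ∧ ofTerms K ((c, l) :: L) ≠ 0 := by
  classical
  set q := ofTerms K L with hq
  have hsum : ofTerms K ((c, l) :: L) = monomial (listExponent l) (c : K) + q := by
    rw [hq, ofTerms, ofTerms, List.map_cons, List.sum_cons, prod_map_X, C_mul_monomial, mul_one]
  have hdeg : m.degree (monomial (listExponent l) (c : K)) = listExponent l := by
    rw [degree_monomial, if_neg hc]
  have hmon : monomial (listExponent l) (c : K) ≠ 0 := by simpa using hc
  rw [hsum]
  by_cases hq0 : q = 0
  · rw [hq0, add_zero]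
    exact ⟨hdeg, hmon⟩
  have hlt := lt_of_mem_support_ofTerms h (m.degree_mem_support hq0)
  have hadd := m.degree_add_of_lt (f := monomial (listExponent l) (c : K)) (g := q)
    (by rwa [hdeg])
  refine ⟨hadd.trans hdeg, fun h0 => ?_⟩
  rw [add_eq_zero_iff_eq_neg] at h0
  rw [← hdeg, h0, degree_neg] at hlt
  exact lt_irrefl _ hlt

end Lists

/-! ### Lexicographic orders from rankings of the variables. -/

section Ranked

variable {σ : Type*} [Finite σ]

/-- The lexicographic order in which variables of smaller rank are larger. -/
noncomputable def lexOfRank (r : σ → ℕ) (hr : Function.Injective r) : MonomialOrder σ :=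
  letI := LinearOrder.lift' r hr
  MonomialOrder.lex

theorem lexOfRank_lt {r : σ → ℕ} {hr : Function.Injective r} {a b : σ →₀ ℕ}
    (h : ∃ v, a v < b v ∧ ∀ w, r w < r v → a w = b w) : a ≺[lexOfRank r hr] b := by
  let := LinearOrder.lift' r hr
  obtain ⟨v, hv, hw⟩ := h
  exact MonomialOrder.lex_lt_iff.2 (Finsupp.Lex.lt_iff.2 ⟨v, hw, hv⟩)

variable [DecidableEq σ] {K : Type*} [Field K]

/-- A head coefficient of ±1 survives in every characteristic, and the comparison of terms is a
finite check on lists, open to `decide`. -/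
theorem degree_ofTerms_of_rank {r : σ → ℕ} (hr : Function.Injective r) {c : ℤ} (hc : c.natAbs = 1)
    {l : List σ} {L : List (ℤ × List σ)}
    (h : ∀ t ∈ L, ∃ v, t.2.count v < l.count v ∧ ∀ w, r w < r v → t.2.count w = l.count w) :
    (lexOfRank r hr).degree (ofTerms K ((c, l) :: L)) = listExponent l ∧
      ofTerms K ((c, l) :: L) ≠ 0 := by
  refine degree_ofTerms_cons ?_ fun t ht => lexOfRank_lt (by simpa using h t ht)
  rcases Int.natAbs_eq c with h1 | h1 <;> rw [h1, hc] <;> simp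

end Ranked

end MonomialOrder

/-! ### Leading terms of the principal 3-minors and of their Schur forms. -/

section PrincipalMinors

open MvPolynomial MonomialOrder

variable (K : Type*) [Field K]

/-- The principal `3`-minor of the generic `4 × 4` matrix avoiding the index `i`. -/
noncomputable def principalMinor (i : Fin 4) : MvPolynomial (Fin 4 × Fin 4) K :=
  ((Matrix.mvPolynomialX (Fin 4) (Fin 4) K).submatrix i.succAbove i.succAbove).det

/-- A ranking of the variables for which the leading terms of the principal `3`-minors containing
the index `0` are pairwise coprime and avoid the diagonal. -/
def cyclicRank : Fin 4 × Fin 4 → ℕ := fun v =>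
  [(1, 2), (3, 1), (2, 3), (0, 1), (0, 2), (0, 3), (1, 0), (2, 0), (3, 0), (1, 3), (2, 1), (3, 2),
    (0, 0), (1, 1), (2, 2), (3, 3)].idxOf v

theorem cyclicRank_injective : Function.Injective cyclicRank := by decide

/-- A ranking of the variables for which the leading terms of the principal `3`-minors are
pairwise coprime after the Schur complement with respect to the index `0`. -/
def schurRank : Fin 4 × Fin 4 → ℕ := fun v =>
  [(0, 1), (2, 0), (3, 1), (2, 3), (1, 1), (1, 2), (0, 0), (0, 2), (0, 3), (1, 0), (3, 0), (1, 3),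
    (2, 1), (3, 2), (2, 2), (3, 3)].idxOf v

theorem schurRank_injective : Function.Injective schurRank := by decide

/-- The term listed first is the leading one for `cyclicRank`; likewise in the next two expansions.
-/
theorem principalMinor_one : principalMinor K 1 = ofTerms K
    [(1, [(0, 2), (2, 3), (3, 0)]), (1, [(0, 0), (2, 2), (3, 3)]), (-1, [(0, 0), (2, 3), (3, 2)]),
      (-1, [(0, 2), (2, 0), (3, 3)]), (1, [(0, 3), (2, 0), (3, 2)]),
      (-1, [(0, 3), (2, 2), (3, 0)])] := by
  simp [principalMinor, ofTerms, Matrix.det_fin_three, Fin.succAbove, Fin.lt_def]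
  ring

theorem principalMinor_two : principalMinor K 2 = ofTerms K
    [(1, [(0, 3), (1, 0), (3, 1)]), (1, [(0, 0), (1, 1), (3, 3)]), (-1, [(0, 0), (1, 3), (3, 1)]),
      (-1, [(0, 1), (1, 0), (3, 3)]), (1, [(0, 1), (1, 3), (3, 0)]),
      (-1, [(0, 3), (1, 1), (3, 0)])] := by
  simp [principalMinor, ofTerms, Matrix.det_fin_three, Fin.succAbove, Fin.lt_def]
  ring

theorem principalMinor_three : principalMinor K 3 = ofTerms K
    [(1, [(0, 1), (1, 2), (2, 0)]), (1, [(0, 0), (1, 1), (2, 2)]), (-1, [(0, 0), (1, 2), (2, 1)]),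
      (-1, [(0, 1), (1, 0), (2, 2)]), (1, [(0, 2), (1, 0), (2, 1)]),
      (-1, [(0, 2), (1, 1), (2, 0)])] := by
  simp [principalMinor, ofTerms, Matrix.det_fin_three, Fin.succAbove, Fin.lt_def]
  ring

theorem degree_principalMinor_one :
    (lexOfRank cyclicRank cyclicRank_injective).degree (principalMinor K 1) =
      listExponent [(0, 2), (2, 3), (3, 0)] ∧ principalMinor K 1 ≠ 0 := by
  rw [principalMinor_one]
  exact degree_ofTerms_of_rank _ rfl (by decide)

theorem degree_principalMinor_two :
    (lexOfRank cyclicRank cyclicRank_injective).degree (principalMinor K 2) =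
      listExponent [(0, 3), (1, 0), (3, 1)] ∧ principalMinor K 2 ≠ 0 := by
  rw [principalMinor_two]
  exact degree_ofTerms_of_rank _ rfl (by decide)

theorem degree_principalMinor_three :
    (lexOfRank cyclicRank cyclicRank_injective).degree (principalMinor K 3) =
      listExponent [(0, 1), (1, 2), (2, 0)] ∧ principalMinor K 3 ≠ 0 := by
  rw [principalMinor_three]
  exact degree_ofTerms_of_rank _ rfl (by decide)

/-- The three principal `3`-minors containing the index `0`. -/
def borderedMinors : Set (MvPolynomial (Fin 4 × Fin 4) K) :=
  {principalMinor K 1, principalMinor K 2, principalMinor K 3}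

theorem isGroebner_borderedMinors :
    (lexOfRank cyclicRank cyclicRank_injective).IsGroebner (borderedMinors K) := by
  obtain ⟨h1, h1'⟩ := degree_principalMinor_one K
  obtain ⟨h2, h2'⟩ := degree_principalMinor_two K
  obtain ⟨h3, h3'⟩ := degree_principalMinor_three K
  rw [borderedMinors, ← insert_empty_eq (principalMinor K 3)]
  refine IsGroebner.insert (IsGroebner.insert (IsGroebner.insert isGroebner_empty h3' ?_) h2' ?_)
    h1' ?_
  · simp
  · rintro b (rfl | h)
    swap
    · exact h.elim
    rw [h2, h3]
    exact disjoint_support_listExponent (by decide)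
  · rintro b (rfl | rfl | h)
    · rw [h1, h2]
      exact disjoint_support_listExponent (by decide)
    · rw [h1, h3]
      exact disjoint_support_listExponent (by decide)
    · exact h.elim


variable {K}

theorem mem_span_borderedMinors_of_mul_pow_mem {a : MvPolynomial (Fin 4 × Fin 4) K} (N : ℕ)
    (h : a * X (0, 0) ^ N ∈ Ideal.span (borderedMinors K)) :
    a ∈ Ideal.span (borderedMinors K) := by
  refine (isGroebner_borderedMinors K).mem_of_mul_mem (pow_ne_zero N (X_ne_zero _)) ?_ h
  rintro b (rfl | rfl | rfl)
  · rw [(degree_principalMinor_one K).1, degree_X_pow]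
    exact disjoint_support_listExponent (by simp)
  · rw [(degree_principalMinor_two K).1, degree_X_pow]
    exact disjoint_support_listExponent (by simp)
  · rw [(degree_principalMinor_three K).1, degree_X_pow]
    exact disjoint_support_listExponent (by simp)

/-- The leading terms avoid the diagonal, so adjoining a power of x_00 keeps a Gröbner set, still
coprime to x_11. -/
theorem mem_span_insert_borderedMinors_of_mul_pow_mem {a : MvPolynomial (Fin 4 × Fin 4) K}
    (M N : ℕ)
    (h : a * X (1, 1) ^ N ∈ Ideal.span (insert (X (0, 0) ^ M) (borderedMinors K))) :
    a ∈ Ideal.span (insert (X (0, 0) ^ M) (borderedMinors K)) := by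
  refine ((isGroebner_borderedMinors K).insert (pow_ne_zero M (X_ne_zero _)) ?_).mem_of_mul_mem
    (pow_ne_zero N (X_ne_zero _)) ?_ h
  · rintro b (rfl | rfl | rfl)
    · rw [(degree_principalMinor_one K).1, degree_X_pow]
      exact disjoint_support_listExponent (by simp)
    · rw [(degree_principalMinor_two K).1, degree_X_pow]
      exact disjoint_support_listExponent (by simp)
    · rw [(degree_principalMinor_three K).1, degree_X_pow]
      exact disjoint_support_listExponent (by simp)
  · rintro b (rfl | rfl | rfl | rfl)
    · rw [degree_X_pow, degree_X_pow]
      refine disjoint_support_listExponent fun v hv hv' => ?_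
      rw [List.eq_of_mem_replicate hv] at hv'
      exact absurd (List.eq_of_mem_replicate hv') (by decide)
    · rw [(degree_principalMinor_one K).1, degree_X_pow]
      exact disjoint_support_listExponent (by simp)
    · rw [(degree_principalMinor_two K).1, degree_X_pow]
      exact disjoint_support_listExponent (by simp)
    · rw [(degree_principalMinor_three K).1, degree_X_pow]
      exact disjoint_support_listExponent (by simp)

variable (K)

/-- The principal `2`-minor avoiding the indices `0` and `1`. -/
noncomputable def schurMinorOne : MvPolynomial (Fin 4 × Fin 4) K :=
  ofTerms K [(-1, [(2, 3), (3, 2)]), (1, [(2, 2), (3, 3)])]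

/-- The principal `2`-minor avoiding the indices `0` and `2`. -/
noncomputable def schurMinorTwo : MvPolynomial (Fin 4 × Fin 4) K :=
  ofTerms K [(-1, [(1, 3), (3, 1)]), (1, [(1, 1), (3, 3)])]

/-- The principal `2`-minor avoiding the indices `0` and `3`. -/
noncomputable def schurMinorThree : MvPolynomial (Fin 4 × Fin 4) K :=
  ofTerms K [(1, [(1, 1), (2, 2)]), (-1, [(1, 2), (2, 1)])]

/-- The determinant of `Y + c r`, where `Y`, `c` and `r` are the blocks of the generic matrix
outside its corner. -/
noncomputable def schurDet : MvPolynomial (Fin 4 × Fin 4) K :=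
  ofTerms K
    [(-1, [(0, 1), (2, 0), (1, 2), (3, 3)]), (1, [(1, 1), (2, 2), (3, 3)]),
      (-1, [(1, 1), (2, 3), (3, 2)]), (-1, [(1, 2), (2, 1), (3, 3)]),
      (1, [(1, 2), (2, 3), (3, 1)]), (1, [(1, 3), (2, 1), (3, 2)]),
      (-1, [(1, 3), (2, 2), (3, 1)]), (1, [(0, 1), (1, 0), (2, 2), (3, 3)]),
      (-1, [(0, 1), (1, 0), (2, 3), (3, 2)]), (-1, [(0, 2), (1, 0), (2, 1), (3, 3)]),
      (1, [(0, 2), (1, 0), (2, 3), (3, 1)]), (1, [(0, 3), (1, 0), (2, 1), (3, 2)]),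
      (-1, [(0, 3), (1, 0), (2, 2), (3, 1)]), (1, [(0, 1), (2, 0), (1, 3), (3, 2)]),
      (1, [(0, 2), (2, 0), (1, 1), (3, 3)]), (-1, [(0, 2), (2, 0), (1, 3), (3, 1)]),
      (-1, [(0, 3), (2, 0), (1, 1), (3, 2)]), (1, [(0, 3), (2, 0), (1, 2), (3, 1)]),
      (1, [(0, 1), (3, 0), (1, 2), (2, 3)]), (-1, [(0, 1), (3, 0), (1, 3), (2, 2)]),
      (-1, [(0, 2), (3, 0), (1, 1), (2, 3)]), (1, [(0, 2), (3, 0), (1, 3), (2, 1)]),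
      (1, [(0, 3), (3, 0), (1, 1), (2, 2)]), (-1, [(0, 3), (3, 0), (1, 2), (2, 1)])]

theorem degree_schurMinorOne :
    (lexOfRank schurRank schurRank_injective).degree (schurMinorOne K) =
      listExponent [(2, 3), (3, 2)] ∧ schurMinorOne K ≠ 0 :=
  degree_ofTerms_of_rank _ rfl (by decide)

theorem degree_schurMinorTwo :
    (lexOfRank schurRank schurRank_injective).degree (schurMinorTwo K) =
      listExponent [(1, 3), (3, 1)] ∧ schurMinorTwo K ≠ 0 :=
  degree_ofTerms_of_rank _ rfl (by decide)

theorem degree_schurMinorThree :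
    (lexOfRank schurRank schurRank_injective).degree (schurMinorThree K) =
      listExponent [(1, 1), (2, 2)] ∧ schurMinorThree K ≠ 0 :=
  degree_ofTerms_of_rank _ rfl (by decide)

theorem degree_schurDet :
    (lexOfRank schurRank schurRank_injective).degree (schurDet K) =
      listExponent [(0, 1), (2, 0), (1, 2), (3, 3)] ∧ schurDet K ≠ 0 :=
  degree_ofTerms_of_rank _ rfl (by decide)

/-- The principal `2`-minors of the Schur complement of the index `0`. -/
def schurMinors : Set (MvPolynomial (Fin 4 × Fin 4) K) :=
  {schurMinorOne K, schurMinorTwo K, schurMinorThree K}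

theorem isGroebner_schurMinors :
    (lexOfRank schurRank schurRank_injective).IsGroebner (schurMinors K) := by
  obtain ⟨h1, h1'⟩ := degree_schurMinorOne K
  obtain ⟨h2, h2'⟩ := degree_schurMinorTwo K
  obtain ⟨h3, h3'⟩ := degree_schurMinorThree K
  rw [schurMinors, ← insert_empty_eq (schurMinorThree K)]
  refine IsGroebner.insert (IsGroebner.insert (IsGroebner.insert isGroebner_empty h3' ?_) h2' ?_)
    h1' ?_
  · simp
  · rintro b (rfl | h)
    swap
    · exact h.elim
    rw [h2, h3]
    exact disjoint_support_listExponent (by decide)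
  · rintro b (rfl | rfl | h)
    · rw [h1, h2]
      exact disjoint_support_listExponent (by decide)
    · rw [h1, h3]
      exact disjoint_support_listExponent (by decide)
    · exact h.elim

theorem disjoint_degree_schurDet : ∀ b ∈ schurMinors K,
    Disjoint ((lexOfRank schurRank schurRank_injective).degree b).support
      ((lexOfRank schurRank schurRank_injective).degree (schurDet K)).support := by
  rintro b (rfl | rfl | rfl)
  · rw [(degree_schurMinorOne K).1, (degree_schurDet K).1]
    exact disjoint_support_listExponent (by decide)
  · rw [(degree_schurMinorTwo K).1, (degree_schurDet K).1]
    exact disjoint_support_listExponent (by decide)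
  · rw [(degree_schurMinorThree K).1, (degree_schurDet K).1]
    exact disjoint_support_listExponent (by decide)

theorem isRadical_span_insert_schurDet :
    (Ideal.span (insert (schurDet K) (schurMinors K))).IsRadical := by
  refine ((isGroebner_schurMinors K).insert (degree_schurDet K).2
    (disjoint_degree_schurDet K)).isRadical ?_
  rintro b (rfl | rfl | rfl | rfl) v
  · rw [(degree_schurDet K).1]
    exact listExponent_le_one (by decide) v
  · rw [(degree_schurMinorOne K).1]
    exact listExponent_le_one (by decide) v
  · rw [(degree_schurMinorTwo K).1]
    exact listExponent_le_one (by decide) v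
  · rw [(degree_schurMinorThree K).1]
    exact listExponent_le_one (by decide) v

variable {K}

theorem mem_span_schurMinors_of_mul_mem {a : MvPolynomial (Fin 4 × Fin 4) K}
    (h : a * schurDet K ∈ Ideal.span (schurMinors K)) : a ∈ Ideal.span (schurMinors K) :=
  (isGroebner_schurMinors K).mem_of_mul_mem (degree_schurDet K).2 (disjoint_degree_schurDet K) h

end PrincipalMinors

/-! ### The Schur substitution and radicality of P_3. -/

section SchurComplement

open MvPolynomial MonomialOrder

variable (K : Type*) [Field K]

/-- The substitution replacing the generic matrix by the matrix with corner `x`, first row `x r`,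
first column `c` and remaining block `Y + c r`. -/
noncomputable def schurSubst :
    MvPolynomial (Fin 4 × Fin 4) K →ₐ[K] MvPolynomial (Fin 4 × Fin 4) K :=
  aeval fun p =>
    if p.1 = 0 then (if p.2 = 0 then X p else X (0, 0) * X p)
    else if p.2 = 0 then X p else X p + X (p.1, 0) * X (0, p.2)

/-- Over the fraction field the substitution is undone by dividing the first row by the corner and
passing to the Schur complement. -/
theorem schurSubst_injective : Function.Injective (schurSubst K) := by
  let F := FractionRing (MvPolynomial (Fin 4 × Fin 4) K)
  let x : Fin 4 × Fin 4 → F := fun p =>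
    algebraMap (MvPolynomial (Fin 4 × Fin 4) K) F (X p)
  have hx : x (0, 0) ≠ 0 := by simp [x]
  let ψ : MvPolynomial (Fin 4 × Fin 4) K →ₐ[K] F := aeval fun p =>
    if p.1 = 0 then (if p.2 = 0 then x p else x p / x (0, 0))
    else if p.2 = 0 then x p else x p - x (p.1, 0) * (x (0, p.2) / x (0, 0))
  have hψ : ψ.comp (schurSubst K) = IsScalarTower.toAlgHom K _ F := by
    ext ⟨i, j⟩
    by_cases hi : i = 0 <;> by_cases hj : j = 0 <;>
      simp [ψ, schurSubst, hi, hj, mul_div_cancel₀, hx] <;> rfl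
  have hinj : Function.Injective (ψ.comp (schurSubst K)) := by
    rw [hψ]
    exact IsFractionRing.injective _ F
  exact Function.Injective.of_comp (f := ψ) hinj

variable {K}

theorem exists_schurSubst_eq_pow_mul (b : MvPolynomial (Fin 4 × Fin 4) K) :
    ∃ N c, schurSubst K c = X (0, 0) ^ N * b := by
  have h0 : schurSubst K (X (0, 0)) = X (0, 0) := by simp [schurSubst]
  induction b using MvPolynomial.induction_on with
  | C a => exact ⟨0, C a, by simp [schurSubst]⟩
  | add p q hp hq =>
    obtain ⟨M, c, hc⟩ := hp
    obtain ⟨N, d, hd⟩ := hq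
    refine ⟨M + N, X (0, 0) ^ N * c + X (0, 0) ^ M * d, ?_⟩
    rw [map_add, map_mul, map_mul, map_pow, map_pow, h0, hc, hd]
    ring
  | mul_X p v hp =>
    obtain ⟨M, c, hc⟩ := hp
    obtain ⟨d, hd⟩ : ∃ d, schurSubst K d = X (0, 0) * X v := by
      obtain ⟨i, j⟩ := v
      by_cases hi : i = 0 <;> by_cases hj : j = 0
      · exact ⟨X (0, 0) * X (0, 0), by simp [schurSubst, hi, hj]⟩
      · exact ⟨X (i, j), by simp [schurSubst, hi, hj]⟩
      · exact ⟨X (0, 0) * X (i, j), by simp [schurSubst, hi, hj]⟩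
      -- The corner times the Schur complement entry, with denominators cleared.
      · exact ⟨X (0, 0) * X (i, j) - X (i, 0) * X (0, j), by
          simp [schurSubst, hi, hj]; ring⟩
    refine ⟨M + 1, c * d, ?_⟩
    rw [map_mul, hc, hd]
    ring

/-- Membership after the substitution implies membership up to a power of the corner entry. -/
theorem exists_mul_pow_mem_of_schurSubst_mem {G : Set (MvPolynomial (Fin 4 × Fin 4) K)}
    {I : Ideal (MvPolynomial (Fin 4 × Fin 4) K)}
    (h : ∀ g ∈ G, ∃ k, ∃ p ∈ I, schurSubst K p = X (0, 0) ^ k * g)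
    {f : MvPolynomial (Fin 4 × Fin 4) K} (hf : schurSubst K f ∈ Ideal.span G) :
    ∃ N, f * X (0, 0) ^ N ∈ I := by
  have h0 : schurSubst K (X (0, 0)) = X (0, 0) := by simp [schurSubst]
  have key : ∀ y ∈ Ideal.span G, ∃ k, ∃ p ∈ I, schurSubst K p = X (0, 0) ^ k * y := by
    intro y hy
    induction hy using Submodule.span_induction with
    | mem g hg => exact h g hg
    | zero => exact ⟨0, 0, I.zero_mem, by simp⟩
    | add y z _ _ hy hz =>
      obtain ⟨M, c, hcI, hc⟩ := hy
      obtain ⟨N, d, hdI, hd⟩ := hz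
      refine ⟨M + N, X (0, 0) ^ N * c + X (0, 0) ^ M * d,
        I.add_mem (I.mul_mem_left _ hcI) (I.mul_mem_left _ hdI), ?_⟩
      rw [map_add, map_mul, map_mul, map_pow, map_pow, h0, hc, hd]
      ring
    | smul a y _ hy =>
      obtain ⟨M, c, hcI, hc⟩ := hy
      obtain ⟨N, d, hd⟩ := exists_schurSubst_eq_pow_mul a
      refine ⟨N + M, d * c, I.mul_mem_left _ hcI, ?_⟩
      rw [map_mul, hc, hd, smul_eq_mul]
      ring
  obtain ⟨N, p, hp, hpf⟩ := key _ hf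
  refine ⟨N, ?_⟩
  have : p = f * X (0, 0) ^ N := schurSubst_injective K (by
    rw [hpf, map_mul, map_pow, h0, mul_comm])
  rwa [← this]

variable (K)

theorem schurSubst_principalMinor_zero : schurSubst K (principalMinor K 0) = schurDet K := by
  simp [principalMinor, schurDet, schurSubst, ofTerms, Matrix.det_fin_three]
  ring

theorem schurSubst_principalMinor_one :
    schurSubst K (principalMinor K 1) = X (0, 0) * schurMinorOne K := by
  simp [principalMinor, schurMinorOne, schurSubst, ofTerms, Matrix.det_fin_three, Fin.succAbove,
    Fin.lt_def]
  ring

theorem schurSubst_principalMinor_two :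
    schurSubst K (principalMinor K 2) = X (0, 0) * schurMinorTwo K := by
  simp [principalMinor, schurMinorTwo, schurSubst, ofTerms, Matrix.det_fin_three, Fin.succAbove,
    Fin.lt_def]
  ring

theorem schurSubst_principalMinor_three :
    schurSubst K (principalMinor K 3) = X (0, 0) * schurMinorThree K := by
  simp [principalMinor, schurMinorThree, schurSubst, ofTerms, Matrix.det_fin_three, Fin.succAbove,
    Fin.lt_def]
  ring

theorem span_borderedMinors_le_comap :
    Ideal.span (borderedMinors K) ≤ (Ideal.span (schurMinors K)).comap (schurSubst K) := by
  rw [Ideal.span_le]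
  rintro b (rfl | rfl | rfl) <;> rw [SetLike.mem_coe, Ideal.mem_comap]
  · rw [schurSubst_principalMinor_one]
    exact Ideal.mul_mem_left _ _ (Ideal.subset_span (by simp [schurMinors]))
  · rw [schurSubst_principalMinor_two]
    exact Ideal.mul_mem_left _ _ (Ideal.subset_span (by simp [schurMinors]))
  · rw [schurSubst_principalMinor_three]
    exact Ideal.mul_mem_left _ _ (Ideal.subset_span (by simp [schurMinors]))

theorem exists_borderedMinors_of_mem_schurMinors : ∀ g ∈ schurMinors K,
    ∃ k, ∃ p ∈ borderedMinors K, schurSubst K p = X (0, 0) ^ k * g := by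
  rintro g (rfl | rfl | rfl)
  · exact ⟨1, principalMinor K 1, by simp [borderedMinors], by
      rw [schurSubst_principalMinor_one, pow_one]⟩
  · exact ⟨1, principalMinor K 2, by simp [borderedMinors], by
      rw [schurSubst_principalMinor_two, pow_one]⟩
  · exact ⟨1, principalMinor K 3, by simp [borderedMinors], by
      rw [schurSubst_principalMinor_three, pow_one]⟩

variable {K}

/-- The fourth principal minor is regular modulo the other three. -/
theorem mem_span_borderedMinors_of_mul_principalMinor_mem {a : MvPolynomial (Fin 4 × Fin 4) K}
    (h : a * principalMinor K 0 ∈ Ideal.span (borderedMinors K)) :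
    a ∈ Ideal.span (borderedMinors K) := by
  have h1 : schurSubst K (a * principalMinor K 0) ∈ Ideal.span (schurMinors K) :=
    span_borderedMinors_le_comap K h
  rw [map_mul, schurSubst_principalMinor_zero] at h1
  obtain ⟨N, hN⟩ := exists_mul_pow_mem_of_schurSubst_mem (I := Ideal.span (borderedMinors K))
    (fun g hg => by
      obtain ⟨k, p, hp, hpg⟩ := exists_borderedMinors_of_mem_schurMinors K g hg
      exact ⟨k, p, Ideal.subset_span hp, hpg⟩) (mem_span_schurMinors_of_mul_mem h1)
  exact mem_span_borderedMinors_of_mul_pow_mem N hN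

variable (K) in
theorem span_range_principalMinor : Ideal.span (Set.range (principalMinor K)) =
    Ideal.span (insert (principalMinor K 0) (borderedMinors K)) := by
  congr 1
  ext p
  simp [borderedMinors, Fin.exists_fin_succ, eq_comm]

/-- The substituted ideal lies in a radical one, with equality up to powers of the corner. -/
theorem exists_mul_X_zero_pow_mem {f : MvPolynomial (Fin 4 × Fin 4) K}
    (hf : f ∈ (Ideal.span (Set.range (principalMinor K))).radical) :
    ∃ N, f * X (0, 0) ^ N ∈ Ideal.span (Set.range (principalMinor K)) := by
  rw [span_range_principalMinor] at hf ⊢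
  have hle : Ideal.span (insert (principalMinor K 0) (borderedMinors K)) ≤
      (Ideal.span (insert (schurDet K) (schurMinors K))).comap (schurSubst K) := by
    rw [Ideal.span_insert, Ideal.span_insert, sup_le_iff, Ideal.span_singleton_le_iff_mem,
      Ideal.mem_comap, schurSubst_principalMinor_zero]
    exact ⟨Ideal.mem_sup_left (Ideal.mem_span_singleton_self _),
      (span_borderedMinors_le_comap K).trans (Ideal.comap_mono le_sup_right)⟩
  obtain ⟨n, hn⟩ := hf
  have h1 : schurSubst K f ∈ Ideal.span (insert (schurDet K) (schurMinors K)) :=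
    isRadical_span_insert_schurDet K ⟨n, by rw [← map_pow]; exact hle hn⟩
  refine exists_mul_pow_mem_of_schurSubst_mem ?_ h1
  rintro g (rfl | hg)
  · exact ⟨0, _, Ideal.subset_span (Set.mem_insert _ _), by
      rw [schurSubst_principalMinor_zero, pow_zero, one_mul]⟩
  · obtain ⟨k, p, hp, hpg⟩ := exists_borderedMinors_of_mem_schurMinors K g hg
    exact ⟨k, p, Ideal.subset_span (Set.mem_insert_of_mem _ hp), hpg⟩

theorem rename_swap_mem {f : MvPolynomial (Fin 4 × Fin 4) K}
    (hf : f ∈ Ideal.span (Set.range (principalMinor K))) :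
    rename (Prod.map (Equiv.swap 0 1) (Equiv.swap 0 1)) f ∈
      Ideal.span (Set.range (principalMinor K)) := by
  suffices Ideal.span (Set.range (principalMinor K)) ≤
      (Ideal.span (Set.range (principalMinor K))).comap
        (rename (R := K) (Prod.map (Equiv.swap (0 : Fin 4) 1) (Equiv.swap (0 : Fin 4) 1))) from
    this hf
  rw [Ideal.span_le]
  rintro _ ⟨i, rfl⟩
  rw [SetLike.mem_coe, Ideal.mem_comap]
  have h : rename (Prod.map (Equiv.swap (0 : Fin 4) 1) (Equiv.swap (0 : Fin 4) 1))
      (principalMinor K i) = principalMinor K (Equiv.swap (0 : Fin 4) 1 i) := by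
    have h2 : Equiv.swap (0 : Fin 4) 1 2 = 2 := by decide
    have h3 : Equiv.swap (0 : Fin 4) 1 3 = 3 := by decide
    fin_cases i <;>
      simp [principalMinor, Matrix.det_fin_three, Fin.succAbove, Fin.lt_def, h2, h3] <;> ring
  rw [h]
  exact Ideal.subset_span ⟨_, rfl⟩

theorem exists_mul_X_one_pow_mem {f : MvPolynomial (Fin 4 × Fin 4) K}
    (hf : f ∈ (Ideal.span (Set.range (principalMinor K))).radical) :
    ∃ N, f * X (1, 1) ^ N ∈ Ideal.span (Set.range (principalMinor K)) := by
  obtain ⟨n, hn⟩ := hf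
  have hr := rename_swap_mem hn
  rw [map_pow] at hr
  obtain ⟨N, hN⟩ := exists_mul_X_zero_pow_mem ⟨n, hr⟩
  refine ⟨N, ?_⟩
  -- The swap is an involution, so a second application returns to `f`.
  have h := rename_swap_mem hN
  rw [map_mul, map_pow, rename_X, rename_rename] at h
  have hid : Prod.map (Equiv.swap (0 : Fin 4) 1) (Equiv.swap (0 : Fin 4) 1) ∘
      Prod.map (Equiv.swap (0 : Fin 4) 1) (Equiv.swap (0 : Fin 4) 1) = id := by
    funext ⟨i, j⟩
    simp
  simpa [hid] using h

/-- Eliminating `f` between the two relations and cancelling g_0 modulo J makes its coefficient `a`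
in the first a multiple of x_00^M modulo J. Then x_00^M cancels as well. -/
theorem mem_of_mul_pow_mem {f : MvPolynomial (Fin 4 × Fin 4) K} {M N : ℕ}
    (h0 : f * X (0, 0) ^ M ∈ Ideal.span (Set.range (principalMinor K)))
    (h1 : f * X (1, 1) ^ N ∈ Ideal.span (Set.range (principalMinor K))) :
    f ∈ Ideal.span (Set.range (principalMinor K)) := by
  rw [span_range_principalMinor, Ideal.mem_span_insert] at *
  obtain ⟨a, y, hy, hay⟩ := h0
  obtain ⟨b, z, hz, hbz⟩ := h1
  have h2 : a * X (1, 1) ^ N - b * X (0, 0) ^ M ∈ Ideal.span (borderedMinors K) := by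
    refine mem_span_borderedMinors_of_mul_principalMinor_mem ?_
    have : (a * X (1, 1) ^ N - b * X (0, 0) ^ M) * principalMinor K 0 =
        X (0, 0) ^ M * z - X (1, 1) ^ N * y := by
      linear_combination X (0, 0) ^ M * hbz - X (1, 1) ^ N * hay
    rw [this]
    exact Ideal.sub_mem _ (Ideal.mul_mem_left _ _ hz) (Ideal.mul_mem_left _ _ hy)
  have h3 : a ∈ Ideal.span (insert (X (0, 0) ^ M) (borderedMinors K)) :=
    mem_span_insert_borderedMinors_of_mul_pow_mem M N
      (Ideal.mem_span_insert.2 ⟨b, _, h2, by ring⟩)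
  obtain ⟨c, w, hw, rfl⟩ := Ideal.mem_span_insert.1 h3
  refine ⟨c, f - c * principalMinor K 0, mem_span_borderedMinors_of_mul_pow_mem M ?_, by ring⟩
  have : (f - c * principalMinor K 0) * X (0, 0) ^ M = principalMinor K 0 * w + y := by
    linear_combination hay
  rw [this]
  exact Ideal.add_mem _ (Ideal.mul_mem_left _ _ hw) hy

variable (K) in
theorem isRadical_span_principalMinor :
    (Ideal.span (Set.range (principalMinor K))).IsRadical := fun _ hf =>
  mem_of_mul_pow_mem (exists_mul_X_zero_pow_mem hf).choose_spec
    (exists_mul_X_one_pow_mem hf).choose_spec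

end SchurComplement

/-! ### Deforming singular matrices of rank three. -/

section Deformation

open Polynomial

/-- The `4 × 4` matrix whose rows other than `1` and columns other than `0` form the block `M`,
whose column `0` is `M s`, whose row `1` is `r M`, and whose remaining entry is `r M s + c`. -/
def borderedMatrix {R : Type*} [CommRing R] (M : Matrix (Fin 3) (Fin 3) R) (s r : Fin 3 → R)
    (c : R) : Matrix (Fin 4) (Fin 4) R :=
  !![(M.mulVec s) 0, M 0 0, M 0 1, M 0 2;
    r ⬝ᵥ M.mulVec s + c, (Matrix.vecMul r M) 0, (Matrix.vecMul r M) 1, (Matrix.vecMul r M) 2;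
    (M.mulVec s) 1, M 1 0, M 1 1, M 1 2;
    (M.mulVec s) 2, M 2 0, M 2 1, M 2 2]

section Identities

variable {R : Type*} [CommRing R] (M : Matrix (Fin 3) (Fin 3) R) (s r : Fin 3 → R) (c : R)

/-- Subtracting the combination of the other columns with weights `s` leaves only `c` in column 0,
at row 1. -/
theorem det_borderedMatrix : (borderedMatrix M s r c).det = -(c * M.det) := by
  rw [Matrix.det_succ_row_zero]
  simp [borderedMatrix, Matrix.det_fin_three, Fin.sum_univ_succ, Matrix.mulVec, Matrix.vecMul,
    dotProduct, Fin.succAbove]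
  ring

theorem adjugate_borderedMatrix_zero :
    (borderedMatrix M s r c).adjugate 0 0 = r 0 * M.det := by
  simp [borderedMatrix, Matrix.adjugate_fin_succ_eq_det_submatrix, Matrix.det_fin_three,
    Fin.sum_univ_succ, Matrix.mulVec, Matrix.vecMul, dotProduct]
  ring

theorem adjugate_borderedMatrix_one :
    (borderedMatrix M s r c).adjugate 1 1 = s 0 * M.det := by
  simp [borderedMatrix, Matrix.adjugate_fin_succ_eq_det_submatrix, Matrix.det_fin_three,
    Fin.sum_univ_succ, Matrix.mulVec, Matrix.vecMul, dotProduct, Fin.succAbove, Fin.lt_def]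
  ring

theorem adjugate_borderedMatrix_two : (borderedMatrix M s r c).adjugate 2 2 =
    -(r 1 * s 1 * M.det) - c * (M 0 0 * M 2 2 - M 0 2 * M 2 0) := by
  simp [borderedMatrix, Matrix.adjugate_fin_succ_eq_det_submatrix, Matrix.det_fin_three,
    Fin.sum_univ_succ, Matrix.mulVec, Matrix.vecMul, dotProduct, Fin.succAbove, Fin.lt_def]
  ring

theorem adjugate_borderedMatrix_three : (borderedMatrix M s r c).adjugate 3 3 =
    -(r 2 * s 2 * M.det) - c * (M 0 0 * M 1 1 - M 0 1 * M 1 0) := by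
  simp [borderedMatrix, Matrix.adjugate_fin_succ_eq_det_submatrix, Matrix.det_fin_three,
    Fin.sum_univ_succ, Matrix.mulVec, Matrix.vecMul, dotProduct, Fin.succAbove, Fin.lt_def]
  ring

theorem borderedMatrix_map {R' : Type*} [CommRing R'] (f : R →+* R') :
    (borderedMatrix M s r c).map f = borderedMatrix (M.map f) (f ∘ s) (f ∘ r) (f c) := by
  ext i j
  fin_cases i <;> fin_cases j <;>
    simp [borderedMatrix, Fin.sum_univ_succ, Matrix.mulVec, Matrix.vecMul, dotProduct]

end Identities

variable {K : Type*} [Field K]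

theorem exists_eq_borderedMatrix (A : Matrix (Fin 4) (Fin 4) K) (h : A.adjugate 0 1 ≠ 0) :
    ∃ M s r c, M.det ≠ 0 ∧ A = borderedMatrix M s r c := by
  set M := A.submatrix (Fin.succAbove 1) (Fin.succAbove 0) with hM
  have hdet : M.det ≠ 0 := by
    rw [Matrix.adjugate_fin_succ_eq_det_submatrix] at h
    exact right_ne_zero_of_mul h
  have hu : IsUnit M.det := hdet.isUnit
  let u : Fin 3 → K := fun i => A (Fin.succAbove 1 i) 0
  let v : Fin 3 → K := fun j => A 1 (Fin.succAbove 0 j)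
  refine ⟨M, M⁻¹.mulVec u, Matrix.vecMul v M⁻¹, A 1 0 - v ⬝ᵥ M⁻¹.mulVec u, hdet, ?_⟩
  have h1 : M.mulVec (M⁻¹.mulVec u) = u := by
    rw [Matrix.mulVec_mulVec, Matrix.mul_nonsing_inv _ hu, Matrix.one_mulVec]
  have h2 : Matrix.vecMul (Matrix.vecMul v M⁻¹) M = v := by
    rw [Matrix.vecMul_vecMul, Matrix.nonsing_inv_mul _ hu, Matrix.vecMul_one]
  have h3 : Matrix.vecMul v M⁻¹ ⬝ᵥ u + (A 1 0 - v ⬝ᵥ M⁻¹.mulVec u) = A 1 0 := by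
    rw [Matrix.dotProduct_mulVec]
    ring
  rw [borderedMatrix, h1, h2, h3]
  ext i j
  fin_cases i <;> fin_cases j <;> rfl

/-- The square leaves one factor of the parameter for each of `p` and `q` when `a` and `b` both
vanish. -/
theorem exists_factorization_deforming {a b κ : K} (h : a * b = 0) :
    ∃ p q : K[X], p.eval 0 = a ∧ q.eval 0 = b ∧ p * q = C κ * Polynomial.X ^ 2 := by
  by_cases ha : a = 0
  · by_cases hb : b = 0
    · exact ⟨Polynomial.X, C κ * Polynomial.X, by simp [ha], by simp [hb], by ring⟩
    · refine ⟨C (κ * b⁻¹) * Polynomial.X ^ 2, C b, by simp [ha], by simp, ?_⟩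
      rw [mul_right_comm, ← C_mul, inv_mul_cancel_right₀ hb]
  · have hb : b = 0 := (mul_eq_zero.1 h).resolve_left ha
    refine ⟨C a, C (κ * a⁻¹) * Polynomial.X ^ 2, by simp, by simp [hb], ?_⟩
    rw [← mul_assoc, ← C_mul, mul_comm a, inv_mul_cancel_right₀ ha]

theorem exists_deformation_of_adjugate_zero_one_ne_zero (A : Matrix (Fin 4) (Fin 4) K)
    (hdiag : ∀ i, A.adjugate i i = 0) (hdet : A.det = 0) (h : A.adjugate 0 1 ≠ 0) :
    ∃ B : Matrix (Fin 4) (Fin 4) K[X],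
      (∀ i, B.adjugate i i = 0) ∧ B.det ≠ 0 ∧ B.map (evalRingHom 0) = A := by
  obtain ⟨M, s, r, c, hM, rfl⟩ := exists_eq_borderedMatrix A h
  rw [det_borderedMatrix, neg_eq_zero] at hdet
  obtain rfl : c = 0 := (mul_eq_zero.1 hdet).resolve_right hM
  have hr0 : r 0 = 0 := by
    have := hdiag 0
    rw [adjugate_borderedMatrix_zero] at this
    exact (mul_eq_zero.1 this).resolve_right hM
  have hs0 : s 0 = 0 := by
    have := hdiag 1
    rw [adjugate_borderedMatrix_one] at this
    exact (mul_eq_zero.1 this).resolve_right hM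
  have h1 : r 1 * s 1 = 0 := by
    have := hdiag 2
    rw [adjugate_borderedMatrix_two, zero_mul, sub_zero, neg_eq_zero] at this
    exact (mul_eq_zero.1 this).resolve_right hM
  have h2 : r 2 * s 2 = 0 := by
    have := hdiag 3
    rw [adjugate_borderedMatrix_three, zero_mul, sub_zero, neg_eq_zero] at this
    exact (mul_eq_zero.1 this).resolve_right hM
  -- With `c` deformed to X², these values of `κ` are exactly those killing the last two diagonal
  -- adjugate entries.
  obtain ⟨p, q, hp, hq, hpq⟩ := exists_factorization_deforming
    (κ := -((M 0 0 * M 2 2 - M 0 2 * M 2 0) * M.det⁻¹)) h1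
  obtain ⟨p', q', hp', hq', hpq'⟩ := exists_factorization_deforming
    (κ := -((M 0 0 * M 1 1 - M 0 1 * M 1 0) * M.det⁻¹)) h2
  have hMC : (M.map C).det = C M.det := (RingHom.map_det C M).symm
  have hinv : C M.det⁻¹ * C M.det = (1 : K[X]) := by
    rw [← C_mul, inv_mul_cancel₀ hM, C_1]
  refine ⟨borderedMatrix (M.map C) ![0, q, q'] ![0, p, p'] (Polynomial.X ^ 2), ?_, ?_, ?_⟩
  · rw [Fin.forall_fin_succ, Fin.forall_fin_succ, Fin.forall_fin_two]
    refine ⟨?_, ?_, ?_, ?_⟩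
    · rw [adjugate_borderedMatrix_zero]
      simp
    · refine (adjugate_borderedMatrix_one ..).trans ?_
      simp
    · refine (adjugate_borderedMatrix_two ..).trans ?_
      simp only [Matrix.cons_val, Matrix.map_apply, hMC, hpq, C_mul, C_neg, C_sub]
      linear_combination (Polynomial.X ^ 2 * (C (M 0 0) * C (M 2 2) - C (M 0 2) * C (M 2 0))) * hinv
    · refine (adjugate_borderedMatrix_three ..).trans ?_
      simp only [Matrix.cons_val, Matrix.map_apply, hMC, hpq', C_mul, C_neg, C_sub]
      linear_combination (Polynomial.X ^ 2 * (C (M 0 0) * C (M 1 1) - C (M 0 1) * C (M 1 0))) * hinv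
  · rw [det_borderedMatrix, hMC]
    exact neg_ne_zero.2 (mul_ne_zero (pow_ne_zero 2 Polynomial.X_ne_zero) (C_ne_zero.2 hM))
  · rw [borderedMatrix_map]
    congr 1
    · ext i j
      simp
    · ext i
      fin_cases i <;> simp [hs0, hq, hq']
    · ext i
      fin_cases i <;> simp [hr0, hp, hp']
    · simp

/-- A singular matrix of rank three with vanishing principal `3`-minors deforms to nonsingular
ones. -/
theorem exists_deformation (A : Matrix (Fin 4) (Fin 4) K)
    (hdiag : ∀ i, A.adjugate i i = 0) (hdet : A.det = 0) {a b : Fin 4} (h : A.adjugate a b ≠ 0) :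
    ∃ B : Matrix (Fin 4) (Fin 4) K[X],
      (∀ i, B.adjugate i i = 0) ∧ B.det ≠ 0 ∧ B.map (evalRingHom 0) = A := by
  have hab : a ≠ b := by
    rintro rfl
    exact h (hdiag a)
  -- Simultaneous row and column permutations preserve the hypotheses, so the nonzero cofactor can
  -- be moved to position (0, 1).
  obtain ⟨e, rfl, rfl⟩ : ∃ e : Equiv.Perm (Fin 4), e 0 = a ∧ e 1 = b := by
    clear h
    revert a b
    decide
  obtain ⟨B, hB, hBdet, hBA⟩ := exists_deformation_of_adjugate_zero_one_ne_zero (A.submatrix e e)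
    (fun i => by rw [Matrix.adjugate_submatrix_equiv_self, Matrix.submatrix_apply, hdiag])
    (by rwa [Matrix.det_submatrix_equiv_self])
    (by rwa [Matrix.adjugate_submatrix_equiv_self])
  refine ⟨B.submatrix e.symm e.symm, fun i => ?_, ?_, ?_⟩
  · rw [Matrix.adjugate_submatrix_equiv_self, Matrix.submatrix_apply, hB]
  · rwa [Matrix.det_submatrix_equiv_self]
  · rw [← Matrix.submatrix_map, hBA]
    ext i j
    simp

end Deformation

/-! ### The intersection formula by evaluation at matrices. -/

section Points

open MvPolynomial

variable {K : Type*} [Field K]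

theorem aeval_det_submatrix {R : Type*} [CommRing R] [Algebra K R] {n m : ℕ}
    (A : Matrix (Fin n) (Fin n) R) (r s : Fin m → Fin n) :
    aeval (fun p : Fin n × Fin n => A p.1 p.2)
      ((Matrix.mvPolynomialX (Fin n) (Fin n) K).submatrix r s).det = (A.submatrix r s).det := by
  rw [AlgHom.map_det]
  congr 1
  ext i j
  simp

theorem aeval_principalMinor {R : Type*} [CommRing R] [Algebra K R]
    (A : Matrix (Fin 4) (Fin 4) R) (i : Fin 4) :
    aeval (fun p : Fin 4 × Fin 4 => A p.1 p.2) (principalMinor K i) = A.adjugate i i := by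
  rw [principalMinor, aeval_det_submatrix, Matrix.adjugate_fin_succ_eq_det_submatrix,
    Even.neg_one_pow ⟨_, rfl⟩, one_mul]

theorem aeval_genericDet {R : Type*} [CommRing R] [Algebra K R]
    (A : Matrix (Fin 4) (Fin 4) R) :
    aeval (fun p : Fin 4 × Fin 4 => A p.1 p.2) (genericDet K 4) = A.det :=
  aeval_det_submatrix A id id

theorem aeval_eq_zero_of_mem_span {R : Type*} [CommRing R] [Algebra K R]
    {A : Matrix (Fin 4) (Fin 4) R} (hA : ∀ i, A.adjugate i i = 0)
    {f : MvPolynomial (Fin 4 × Fin 4) K} (hf : f ∈ Ideal.span (Set.range (principalMinor K))) :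
    aeval (fun p : Fin 4 × Fin 4 => A p.1 p.2) f = 0 := by
  have hle : Ideal.span (Set.range (principalMinor K)) ≤
      RingHom.ker (aeval (R := K) fun p : Fin 4 × Fin 4 => A p.1 p.2) := by
    rw [Ideal.span_le]
    rintro _ ⟨i, rfl⟩
    exact (aeval_principalMinor A i).trans (hA i)
  exact hle hf

theorem exists_eq_succAboveOrderEmb {n : ℕ} (r : Fin n ↪o Fin (n + 1)) :
    ∃ i, r = Fin.succAboveOrderEmb i := by
  obtain ⟨i, hi⟩ : ∃ i, i ∉ Set.range r := by
    by_contra! h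
    simpa using Fintype.card_le_of_surjective r h
  refine ⟨i, DFunLike.coe_injective ((r.strictMono.range_inj
    (Fin.strictMono_succAbove i)).1 (Set.eq_of_subset_of_ncard_le ?_ ?_))⟩
  · rw [Fin.range_succAbove]
    rintro _ ⟨k, rfl⟩ rfl
    exact hi ⟨k, rfl⟩
  · rw [← Set.image_univ, ← Set.image_univ, Set.ncard_image_of_injective _ r.injective,
      Set.ncard_image_of_injective _ Fin.succAbove_right_injective]

variable (K) in
theorem principalMinorIdeal_eq_span :
    principalMinorIdeal K 4 3 = Ideal.span (Set.range (principalMinor K)) := by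
  rw [principalMinorIdeal]
  congr 1
  ext p
  constructor
  · rintro ⟨r, rfl⟩
    obtain ⟨i, rfl⟩ := exists_eq_succAboveOrderEmb r
    exact ⟨i, rfl⟩
  · rintro ⟨i, rfl⟩
    exact ⟨Fin.succAboveOrderEmb i, rfl⟩

theorem mem_contractedPrincipalMinorIdeal_iff {n t : ℕ} {f : MvPolynomial (Fin n × Fin n) K} :
    f ∈ contractedPrincipalMinorIdeal K n t ↔
      ∃ N, f * genericDet K n ^ N ∈ principalMinorIdeal K n t := by
  have hdet : genericDet K n ≠ 0 := Matrix.det_mvPolynomialX_ne_zero (Fin n) K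
  have hinj : Function.Injective (algebraMap (MvPolynomial (Fin n × Fin n) K)
      (Localization.Away (genericDet K n))) :=
    IsLocalization.injective _ (powers_le_nonZeroDivisors_of_noZeroDivisors hdet)
  rw [contractedPrincipalMinorIdeal, Ideal.mem_comap,
    IsLocalization.mem_map_algebraMap_iff (Submonoid.powers (genericDet K n))]
  constructor
  · rintro ⟨⟨p, ⟨_, N, rfl⟩⟩, h⟩
    refine ⟨N, ?_⟩
    rw [← map_mul] at h
    exact hinj h ▸ p.2
  · rintro ⟨N, h⟩
    exact ⟨⟨⟨_, h⟩, ⟨_, N, rfl⟩⟩, by simp⟩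

theorem aeval_eq_zero_of_mem {f : MvPolynomial (Fin 4 × Fin 4) K}
    (hI : f ∈ determinantalIdeal K 4 3) (hQ : f ∈ contractedPrincipalMinorIdeal K 4 3)
    {A : Matrix (Fin 4) (Fin 4) K} (hA : ∀ i, A.adjugate i i = 0) :
    aeval (fun p : Fin 4 × Fin 4 => A p.1 p.2) f = 0 := by
  obtain ⟨N, hN⟩ := mem_contractedPrincipalMinorIdeal_iff.1 hQ
  rw [principalMinorIdeal_eq_span] at hN
  -- Stated over any domain, to serve both for K and for the family over K[X].
  have key : ∀ {R : Type _} [CommRing R] [IsDomain R] [Algebra K R]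
      {B : Matrix (Fin 4) (Fin 4) R}, (∀ i, B.adjugate i i = 0) → B.det ≠ 0 →
      aeval (fun p : Fin 4 × Fin 4 => B p.1 p.2) f = 0 := by
    intro R _ _ _ B hB hdet
    have h := aeval_eq_zero_of_mem_span hB hN
    rw [map_mul, map_pow, aeval_genericDet] at h
    exact (mul_eq_zero.1 h).resolve_right (pow_ne_zero N hdet)
  by_cases hdet : A.det = 0
  · by_cases hrank : ∃ a b, A.adjugate a b ≠ 0
    · obtain ⟨a, b, hab⟩ := hrank
      obtain ⟨B, hB, hBdet, rfl⟩ := exists_deformation A hA hdet hab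
      have h := congrArg (Polynomial.aeval (0 : K)) (key hB hBdet)
      rw [map_zero, ← AlgHom.comp_apply, comp_aeval] at h
      simpa [Polynomial.coe_aeval_eq_eval] using h
    · push Not at hrank
      have hle : determinantalIdeal K 4 3 ≤
          RingHom.ker (aeval (R := K) fun p : Fin 4 × Fin 4 => A p.1 p.2) := by
        rw [determinantalIdeal, Ideal.span_le]
        rintro _ ⟨⟨r, s⟩, rfl⟩
        obtain ⟨i, rfl⟩ := exists_eq_succAboveOrderEmb r
        obtain ⟨j, rfl⟩ := exists_eq_succAboveOrderEmb s
        -- The indices are exchanged because the adjugate transposes cofactors.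
        have h := hrank j i
        rw [Matrix.adjugate_fin_succ_eq_det_submatrix] at h
        refine (aeval_det_submatrix A _ _).trans ?_
        exact (mul_eq_zero.1 h).resolve_left (pow_ne_zero _ (neg_ne_zero.2 one_ne_zero))
      exact hle hI
  · exact key hA hdet

end Points

theorem theorem4p2 (K : Type*) [Field K] [IsAlgClosed K] :
    IsReduced (MvPolynomial (Fin 4 × Fin 4) K ⧸ principalMinorIdeal K 4 3) ∧
      principalMinorIdeal K 4 3 =
        determinantalIdeal K 4 3 ⊓ contractedPrincipalMinorIdeal K 4 3 := by
  have hrad : (principalMinorIdeal K 4 3).IsRadical := by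
    rw [principalMinorIdeal_eq_span]
    exact isRadical_span_principalMinor K
  refine ⟨(Ideal.isRadical_iff_quotient_reduced _).1 hrad, le_antisymm (le_inf ?_ ?_) ?_⟩
  · refine Ideal.span_mono ?_
    rintro _ ⟨r, rfl⟩
    exact ⟨(r, r), rfl⟩
  · exact Ideal.le_comap_map
  · rintro f ⟨hI, hQ⟩
    rw [← hrad.radical, ← MvPolynomial.vanishingIdeal_zeroLocus_eq_radical (K := K),
      MvPolynomial.mem_vanishingIdeal_iff]
    intro x hx
    refine aeval_eq_zero_of_mem hI hQ (A := Matrix.of fun i j => x (i, j)) fun i => ?_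
    rw [← aeval_principalMinor (K := K)]
    refine hx _ ?_
    rw [principalMinorIdeal_eq_span]
    exact Ideal.subset_span ⟨i, rfl⟩
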